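/- Let $n\ge 0$ and let $\mu=(\mu_1\ge\mu_2\ge\dots\ge\mu_n\ge 0)$ and $\nu=(\nu_1\ge\nu_2\ge\dots\ge\nu_n\ge 0)$ be partitions, written with the same number $n$ of parts (zero parts being allowed). Define the pair of partitions $(\mu,\nu)^*=(\lambda,\rho)$, where $\lambda=(\lambda_1,\dots,\lambda_n)$ and $\rho=(\rho_1,\dots,\rho_n)$, by $$\lambda_k:=\mu_k-k+\#\{j \mid 1\le j\le n,\ \nu_j-j\ge \mu_k-k\},\qquad \rho_j:=\nu_j-j+1+\#\{k \mid 1\le k\le n,\ \mu_k-k>\nu_j-j\}.$$ For a partition $\theta$ let $s_\theta$ be the Schur function in infinitely many variables, i.e. the generating function of the semistandard Young tableaux of shape $\theta$; let $h_a:=s_{(a)}$ (so $h_0=1$), and for a partition $\alpha=(\alpha_1,\dots,\alpha_n)$ let $h_\alpha:=h_{\alpha_1}h_{\alpha_2}\cdots h_{\alpha_n}$ be the complete homogeneous symmetric function. A symmetric function is called Schur-positive if all the coefficients in its expansion in the basis of Schur functions are non-negative integers. Proposition. For any pair of partitions $(\mu,\nu)$, if $(\lambda,\rho)=(\mu,\nu)^*$,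 then $$h_\lambda h_\rho-h_\mu h_\nu$$ is Schur-positive. -/

import Mathlib

namespace StarOperation

/-- A partition written with `n` parts, in weakly decreasing order; zero parts are allowed.
The part with (1-based) number `k + 1` is `parts k`. -/
@[ext]
structure PaddedPartition (n : ℕ) where
  parts : Fin n → ℕ
  antitone : Antitone parts

namespace PaddedPartition

variable {n : ℕ}

/-- The shifted part `μ_k - k`, where the parts are numbered from `1` to `n`. -/
def shifted (p : PaddedPartition n) (k : Fin n) : ℤ := (p.parts k : ℤ) - ((k : ℤ) + 1)

theorem shifted_strictAnti (p : PaddedPartition n) : StrictAnti p.shifted := by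
  intro i j hij
  have h1 : p.parts j ≤ p.parts i := p.antitone hij.le
  have h2 : (i : ℕ) < (j : ℕ) := hij
  simp only [shifted]
  omega

end PaddedPartition

variable {n : ℕ}

/-- `λ_k = μ_k - k + #{j | ν_j - j ≥ μ_k - k}`, as an integer. -/
def lambdaPart (μ ν : PaddedPartition n) (k : Fin n) : ℤ :=
  μ.shifted k + ((Finset.univ.filter fun j : Fin n => ν.shifted j ≥ μ.shifted k).card : ℤ)

/-- `ρ_j = ν_j - j + 1 + #{k | μ_k - k > ν_j - j}`, as an integer. -/
def rhoPart (μ ν : PaddedPartition n) (j : Fin n) : ℤ :=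
  ν.shifted j + 1 + ((Finset.univ.filter fun k : Fin n => μ.shifted k > ν.shifted j).card : ℤ)

theorem le_card_of_shifted (p : PaddedPartition n) (m : ℕ) (hm : m ≤ n) :
    m ≤ (Finset.univ.filter fun j : Fin n => p.shifted j ≥ -(m : ℤ)).card := by
  have h : (Finset.univ : Finset (Fin m)).card ≤
      (Finset.univ.filter fun j : Fin n => p.shifted j ≥ -(m : ℤ)).card := by
    refine Finset.card_le_card_of_injOn (fun i => Fin.castLE hm i) ?_ ?_
    · intro i _
      have := i.isLt
      refine Finset.mem_coe.2 (Finset.mem_filter.2 ⟨Finset.mem_univ _, ?_⟩)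
      simp only [PaddedPartition.shifted, Fin.val_castLE]
      omega
    · intro a _ b _ hab
      exact Fin.castLE_injective hm hab
  simpa using h

theorem lambdaPart_nonneg (μ ν : PaddedPartition n) (k : Fin n) : 0 ≤ lambdaPart μ ν k := by
  unfold lambdaPart
  by_cases h : 0 ≤ μ.shifted k
  · positivity
  · have hk := k.isLt
    have hs : μ.shifted k = (μ.parts k : ℤ) - ((k : ℤ) + 1) := rfl
    obtain ⟨m, hm⟩ : ∃ m : ℕ, μ.shifted k = -(m : ℤ) := ⟨(-μ.shifted k).toNat, by omega⟩
    have := le_card_of_shifted ν m (by omega)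
    rw [hm]
    omega

theorem rhoPart_nonneg (μ ν : PaddedPartition n) (j : Fin n) : 0 ≤ rhoPart μ ν j := by
  unfold rhoPart
  by_cases h : 0 ≤ ν.shifted j
  · positivity
  · have hj := j.isLt
    have hs : ν.shifted j = (ν.parts j : ℤ) - ((j : ℤ) + 1) := rfl
    obtain ⟨m, hm⟩ : ∃ m : ℕ, ν.shifted j = -(m : ℤ) - 1 := ⟨(-ν.shifted j - 1).toNat, by omega⟩
    have h1 := le_card_of_shifted μ m (by omega)
    have h2 : (Finset.univ.filter fun k : Fin n => μ.shifted k ≥ -(m : ℤ)) =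
        Finset.univ.filter fun k : Fin n => μ.shifted k > ν.shifted j := by
      ext k
      simp only [Finset.mem_filter, Finset.mem_univ, true_and]
      omega
    rw [h2] at h1
    omega

theorem card_shifted_le (p : PaddedPartition n) {a b : ℤ} (hab : a ≤ b) :
    ((Finset.univ.filter fun j : Fin n => p.shifted j ≥ a).card : ℤ) ≤
      (b - a) + ((Finset.univ.filter fun j : Fin n => p.shifted j ≥ b).card : ℤ) := by
  have h1 : (Finset.univ.filter fun j : Fin n => p.shifted j ≥ a) ⊆
      (Finset.univ.filter fun j : Fin n => p.shifted j ∈ Finset.Ico a b) ∪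
        (Finset.univ.filter fun j : Fin n => p.shifted j ≥ b) := by
    intro j
    simp only [Finset.mem_filter, Finset.mem_univ, true_and, Finset.mem_union, Finset.mem_Ico]
    omega
  have h2 : (Finset.univ.filter fun j : Fin n => p.shifted j ∈ Finset.Ico a b).card ≤
      (Finset.Ico a b).card :=
    Finset.card_le_card_of_injOn p.shifted (fun j hj => by simpa using hj)
      (p.shifted_strictAnti.injective.injOn)
  rw [Int.card_Ico] at h2
  have h3 := (Finset.card_le_card h1).trans (Finset.card_union_le _ _)
  omega

theorem lambdaPart_antitone (μ ν : PaddedPartition n) : Antitone (lambdaPart μ ν) := by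
  intro i j hij
  have h := card_shifted_le ν (μ.shifted_strictAnti.antitone hij)
  unfold lambdaPart
  linarith

theorem rhoPart_antitone (μ ν : PaddedPartition n) : Antitone (rhoPart μ ν) := by
  intro i j hij
  have h := card_shifted_le μ (a := ν.shifted j + 1) (b := ν.shifted i + 1)
    (by have := ν.shifted_strictAnti.antitone hij; omega)
  simp only [ge_iff_le, Int.add_one_le_iff] at h
  unfold rhoPart
  simp only [gt_iff_lt]
  linarith

/-- The `*`-operation `(μ, ν) ↦ (λ, ρ)` on ordered pairs of partitions with `n` parts.
The integers `lambdaPart` and `rhoPart` are nonnegative, so `Int.toNat` loses nothing. -/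
def star (p : PaddedPartition n × PaddedPartition n) :
    PaddedPartition n × PaddedPartition n :=
  (⟨fun k => (lambdaPart p.1 p.2 k).toNat,
      fun _ _ hij => Int.toNat_le_toNat (lambdaPart_antitone p.1 p.2 hij)⟩,
    ⟨fun j => (rhoPart p.1 p.2 j).toNat,
      fun _ _ hij => Int.toNat_le_toNat (rhoPart_antitone p.1 p.2 hij)⟩)

theorem star_fst_parts (μ ν : PaddedPartition n) (k : Fin n) :
    ((star (μ, ν)).1.parts k : ℤ) = lambdaPart μ ν k :=
  Int.toNat_of_nonneg (lambdaPart_nonneg μ ν k)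

theorem star_snd_parts (μ ν : PaddedPartition n) (j : Fin n) :
    ((star (μ, ν)).2.parts j : ℤ) = rhoPart μ ν j :=
  Int.toNat_of_nonneg (rhoPart_nonneg μ ν j)

/-- The content of a semistandard tableau: `content T i` is the number of cells with entry `i`. -/
noncomputable def content {θ : YoungDiagram} (T : SemistandardYoungTableau θ) : ℕ →₀ ℕ :=
  ∑ c ∈ θ.cells, Finsupp.single (T c.1 c.2) 1

/-- Only finitely many semistandard tableaux have a given shape and content. -/
theorem finite_content (θ : YoungDiagram) (d : ℕ →₀ ℕ) :
    Finite {T : SemistandardYoungTableau θ // content T = d} := by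
  have hmem : ∀ T : {T : SemistandardYoungTableau θ // content T = d}, ∀ c : θ.cells,
      T.1 c.1.1 c.1.2 ∈ d.support := by
    rintro ⟨T, rfl⟩ ⟨c, hc⟩
    rw [Finsupp.mem_support_iff]
    unfold content
    rw [Finsupp.finsetSum_apply]
    refine (Finset.sum_pos' (fun _ _ => Nat.zero_le _) ⟨c, hc, ?_⟩).ne'
    simp
  refine Finite.of_injective
    (fun T => fun c : θ.cells => (⟨T.1 c.1.1 c.1.2, hmem T c⟩ : d.support)) ?_
  intro S T hST
  apply Subtype.ext
  apply SemistandardYoungTableau.ext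
  intro i j
  by_cases hc : (i, j) ∈ θ
  · have := congrFun hST ⟨(i, j), hc⟩
    exact congrArg Subtype.val this
  · rw [S.1.zeros hc, T.1.zeros hc]

/-- The Schur function `s_θ` in the variables `x_0, x_1, x_2, …`, with integer coefficients: the
sum of the monomials `x ^ content T` over all semistandard tableaux `T` of shape `θ`. -/
noncomputable def schur (θ : YoungDiagram) : MvPowerSeries ℕ ℤ :=
  fun d => (Nat.card {T : SemistandardYoungTableau θ // content T = d} : ℤ)

/-- The diagram with a single row of `a` cells (the empty diagram if `a = 0`). -/
def oneRow (a : ℕ) : YoungDiagram := YoungDiagram.ofRowLens [a] (List.pairwise_singleton _ a).sortedGE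

/-- The complete homogeneous symmetric function `h_a = s_(a)`. -/
noncomputable def completeHomogeneous (a : ℕ) : MvPowerSeries ℕ ℤ := schur (oneRow a)

/-- `h_μ = h_{μ_1} h_{μ_2} ⋯ h_{μ_n}`; zero parts contribute the factor `h_0 = 1`. -/
noncomputable def completeHomogeneousProd (μ : PaddedPartition n) : MvPowerSeries ℕ ℤ :=
  ∏ k : Fin n, completeHomogeneous (μ.parts k)

/-- `f` is a (finite) linear combination of Schur functions whose coefficients are nonnegative
integers. As the Schur functions are linearly independent, the coefficients are determined by
`f`. -/
def SchurPositive (f : MvPowerSeries ℕ ℤ) : Prop :=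
  ∃ c : YoungDiagram →₀ ℤ, f = c.sum (fun θ a => a • schur θ) ∧ ∀ θ, 0 ≤ c θ

end StarOperation

/-! Merge the numbers `μ_k - k` and `ν_j - j` into one decreasing sequence, a `ν` entry preceding an
equal `μ` entry, and read `μ` entries as up-steps and `ν` entries as down-steps of a lattice path
from height 0 to height 0. Then `λ_k = μ_k - e`, with `e` the height after up-step `k`, and `ρ_j =
ν_j + f`, with `f` the height before down-step `j`. The steps joining heights `e - 1` and `e`
alternate between up and down and are equally many of each kind, so the `k` can be matched with the
`j` so that `e = f`, whence `λ_k + ρ_j = μ_k + ν_j` (`rel_of_excess_eq`). The up-step of a pair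
comes first exactly when `e > 0`; then `λ_k, ρ_j ≤ μ_k`, and otherwise `λ_k, ρ_j ≤ ν_j`.

For each pair, `h_{λ_k} h_{ρ_j} - h_{μ_k} h_{ν_j}` is Schur-positive by the Pieri rule for two rows
(`sub_mem_schurCone_of_le`). The differences telescope, since multiplication by any `h_a` preserves
Schur-positivity (`prod_sub_prod_mem_schurCone`). The Pieri rule is proved by induction on the
number of variables, from a growth-diagram bijection that commutes adding and removing horizontal
strips (`sum_addStrip_removeStrip`). -/

open Finset

/-! ### Young diagrams through their row lengths, horizontal strips and growth rules -/

namespace YoungDiagram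

theorem ext_rowLen {θ η : YoungDiagram} (h : ∀ i, θ.rowLen i = η.rowLen i) : θ = η := by
  apply YoungDiagram.ext
  ext ⟨i, j⟩
  rw [mem_cells, mem_cells, mem_iff_lt_rowLen, mem_iff_lt_rowLen, h]

theorem exists_rowLen_eq_zero (θ : YoungDiagram) : ∃ M, ∀ i, M ≤ i → θ.rowLen i = 0 := by
  refine ⟨θ.colLen 0, fun i hi => ?_⟩
  by_contra h
  have := mem_iff_lt_colLen.1 (mem_iff_lt_rowLen.2 (Nat.pos_of_ne_zero h))
  omega

theorem card_eq_sum_rowLen (θ : YoungDiagram) {M : ℕ} (h : θ.rowLen M = 0) :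
    θ.card = ∑ i ∈ range M, θ.rowLen i := by
  have hmaps : ∀ c ∈ θ.cells, c.1 ∈ range M := by
    rintro ⟨i, j⟩ hc
    rw [mem_cells, mem_iff_lt_rowLen] at hc
    by_contra hi
    have := θ.rowLen_anti M i (by simpa using hi)
    omega
  rw [YoungDiagram.card, card_eq_sum_card_fiberwise hmaps]
  exact sum_congr rfl fun i _ => (θ.rowLen_eq_card).symm

theorem mem_range_prod_of_mem {θ : YoungDiagram} {c : ℕ × ℕ} (hc : c ∈ θ) :
    c ∈ range θ.card ×ˢ range θ.card := by
  obtain ⟨i, j⟩ := c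
  have h1 : i < θ.colLen j := mem_iff_lt_colLen.1 hc
  have h2 : j < θ.rowLen i := mem_iff_lt_rowLen.1 hc
  have h3 : θ.colLen j ≤ θ.card := by
    rw [colLen_eq_card]; exact card_le_card (filter_subset _ _)
  have h4 : θ.rowLen i ≤ θ.card := by
    rw [rowLen_eq_card]; exact card_le_card (filter_subset _ _)
  simp only [mem_product, mem_range]
  omega

theorem finite_card_le (m : ℕ) : {θ : YoungDiagram | θ.card ≤ m}.Finite := by
  refine Set.Finite.of_finite_image (f := YoungDiagram.cells)
    (((range m ×ˢ range m).powerset).finite_toSet.subset ?_) ?_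
  · rintro _ ⟨θ, hθ, rfl⟩
    rw [mem_coe, mem_powerset]
    intro c hc
    have := mem_range_prod_of_mem ((mem_cells c).1 hc)
    have h : θ.card ≤ m := hθ
    simp only [mem_product, mem_range] at this ⊢
    omega
  · intro θ _ η _ h
    exact YoungDiagram.ext h

/-- The Young diagram with row lengths `f`, provided that `f` is weakly decreasing and eventually
zero; the empty diagram otherwise. -/
noncomputable def ofRowLenFun (f : ℕ → ℕ) : YoungDiagram :=
  open Classical in
  if h : Antitone f ∧ ∃ M, f M = 0 then
    { cells := (range h.2.choose ×ˢ range (f 0)).filter fun c => c.2 < f c.1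
      isLowerSet := by
        rintro ⟨i, j⟩ ⟨i', j'⟩ ⟨hi : i' ≤ i, hj : j' ≤ j⟩ hc
        simp only [coe_filter, mem_product, mem_range, Set.mem_ofPred_eq] at hc ⊢
        have := h.1 hi
        omega }
  else ⊥

theorem rowLen_ofRowLenFun {f : ℕ → ℕ} (hf : Antitone f) (hz : ∃ M, f M = 0) (i : ℕ) :
    (ofRowLenFun f).rowLen i = f i := by
  have h : Antitone f ∧ ∃ M, f M = 0 := ⟨hf, hz⟩
  have key : ∀ j, j < (ofRowLenFun f).rowLen i ↔ j < f i := by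
    intro j
    rw [← mem_iff_lt_rowLen, ← mem_cells, ofRowLenFun, dif_pos h]
    simp only [mem_filter, mem_product, mem_range, and_iff_right_iff_imp]
    intro hj
    have h0 := hf (Nat.zero_le i)
    refine ⟨?_, by omega⟩
    by_contra hi
    have := hf (not_lt.1 hi)
    have := h.2.choose_spec
    omega
  have h1 := key (f i)
  have h2 := key ((ofRowLenFun f).rowLen i)
  omega

/-- `θ / η` is a horizontal strip, in terms of row lengths. -/
def IsHorizontalStrip (η θ : YoungDiagram) : Prop :=
  ∀ i, θ.rowLen (i + 1) ≤ η.rowLen i ∧ η.rowLen i ≤ θ.rowLen i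

namespace IsHorizontalStrip

variable {η θ : YoungDiagram}

theorem le (h : IsHorizontalStrip η θ) : η ≤ θ := by
  rintro ⟨i, j⟩ hc
  have := (h i).2
  exact mem_iff_lt_rowLen.2 ((mem_iff_lt_rowLen.1 hc).trans_le this)

theorem card_le (h : IsHorizontalStrip η θ) : η.card ≤ θ.card :=
  Finset.card_le_card (cells_subset_iff.2 h.le)

theorem mem_of_succ_mem (h : IsHorizontalStrip η θ) {i j : ℕ} (hc : (i + 1, j) ∈ θ) :
    (i, j) ∈ η :=
  mem_iff_lt_rowLen.2 ((mem_iff_lt_rowLen.1 hc).trans_le (h i).1)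

theorem of_mem (hle : η ≤ θ) (h : ∀ i j, (i + 1, j) ∈ θ → (i, j) ∈ η) :
    IsHorizontalStrip η θ := by
  refine fun i => ⟨?_, ?_⟩
  · by_contra! hlt
    have := mem_iff_lt_rowLen.1 (h i _ (mem_iff_lt_rowLen.2 hlt))
    omega
  · by_contra! hlt
    have : (i, θ.rowLen i) ∈ θ := hle (mem_iff_lt_rowLen.2 hlt)
    have := mem_iff_lt_rowLen.1 this
    omega

end IsHorizontalStrip

/-- The diagrams obtained from `θ` by removing a horizontal strip. -/
noncomputable def removeStrip (θ : YoungDiagram) : Finset YoungDiagram :=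
  ((finite_card_le θ.card).subset
    (fun _ h => IsHorizontalStrip.card_le h : {η | IsHorizontalStrip η θ} ⊆ _)).toFinset

/-- The diagrams obtained from `θ` by adding a horizontal strip of `a` cells. -/
noncomputable def addStrip (θ : YoungDiagram) (a : ℕ) : Finset YoungDiagram :=
  ((finite_card_le (θ.card + a)).subset
    (fun _ h => h.2.le :
      {κ | IsHorizontalStrip θ κ ∧ κ.card = θ.card + a} ⊆ _)).toFinset

@[simp]
theorem mem_removeStrip {η θ : YoungDiagram} : η ∈ θ.removeStrip ↔ IsHorizontalStrip η θ := by
  simp [removeStrip]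

@[simp]
theorem mem_addStrip {θ κ : YoungDiagram} {a : ℕ} :
    κ ∈ θ.addStrip a ↔ IsHorizontalStrip θ κ ∧ κ.card = θ.card + a := by
  simp [addStrip]

/-- The lower corner of the growth-diagram square with sides `θ`, `η` and upper corner `κ`. -/
noncomputable def growthDown (θ η κ : YoungDiagram) : YoungDiagram :=
  ofRowLenFun fun i => max (θ.rowLen (i + 1)) (η.rowLen (i + 1)) + min (θ.rowLen i) (η.rowLen i) -
    κ.rowLen (i + 1)

/-- The upper corner of the growth-diagram square with sides `θ`, `η`, lower corner `τ` and
label `c`. -/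
noncomputable def growthUp (θ η τ : YoungDiagram) (c : ℕ) : YoungDiagram :=
  ofRowLenFun fun i => match i with
    | 0 => max (θ.rowLen 0) (η.rowLen 0) + c
    | i + 1 => max (θ.rowLen (i + 1)) (η.rowLen (i + 1)) + min (θ.rowLen i) (η.rowLen i) -
        τ.rowLen i

variable {θ η κ τ : YoungDiagram}

/-- Both strips confine row `i + 1` of `κ` to the interval from `max (θ_{i+1}, η_{i+1})` to `min
(θ_i, η_i)`. The formula reflects it in that interval, so the subtraction is exact and the resulting
rows interlace with `θ` and `η`. -/
theorem rowLen_growthDown (h : IsHorizontalStrip θ κ) (h' : IsHorizontalStrip η κ) (i : ℕ) :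
    (growthDown θ η κ).rowLen i = max (θ.rowLen (i + 1)) (η.rowLen (i + 1)) +
      min (θ.rowLen i) (η.rowLen i) - κ.rowLen (i + 1) := by
  refine rowLen_ofRowLenFun (antitone_nat_of_succ_le fun i => ?_) ?_ i
  · have := h i
    have := h' i
    have := h (i + 1)
    have := h' (i + 1)
    have := h (i + 1 + 1)
    have := h' (i + 1 + 1)
    omega
  · obtain ⟨M, hM⟩ := κ.exists_rowLen_eq_zero
    have := hM M le_rfl
    have := hM (M + 1) (by omega)
    have := h M
    have := h' M
    have := h (M + 1)
    have := h' (M + 1)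
    exact ⟨M, by omega⟩

theorem rowLen_growthUp (h : IsHorizontalStrip τ θ) (h' : IsHorizontalStrip τ η) (c i : ℕ) :
    (growthUp θ η τ c).rowLen i = match i with
    | 0 => max (θ.rowLen 0) (η.rowLen 0) + c
    | i + 1 => max (θ.rowLen (i + 1)) (η.rowLen (i + 1)) + min (θ.rowLen i) (η.rowLen i) -
        τ.rowLen i := by
  refine rowLen_ofRowLenFun (antitone_nat_of_succ_le fun i => ?_) ?_ i
  · cases i with
    | zero =>
      have := h 0
      have := h' 0
      dsimp only
      omega
    | succ i =>
      have := h i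
      have := h' i
      have := h (i + 1)
      have := h' (i + 1)
      dsimp only
      omega
  · obtain ⟨M, hM⟩ := θ.exists_rowLen_eq_zero
    obtain ⟨M', hM'⟩ := η.exists_rowLen_eq_zero
    have := hM (M + M') (by omega)
    have := hM (M + M' + 1) (by omega)
    have := hM' (M + M') (by omega)
    have := hM' (M + M' + 1) (by omega)
    refine ⟨M + M' + 1, ?_⟩
    dsimp only
    omega

/-- Sum the local rule over all rows: row 0 supplies the one missing maximum, and `max + min` is the
sum of the two sides. -/
theorem card_growth {c : ℕ} (h0 : κ.rowLen 0 = max (θ.rowLen 0) (η.rowLen 0) + c)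
    (h : ∀ i, κ.rowLen (i + 1) + τ.rowLen i =
      max (θ.rowLen (i + 1)) (η.rowLen (i + 1)) + min (θ.rowLen i) (η.rowLen i)) :
    κ.card + τ.card = c + θ.card + η.card := by
  obtain ⟨M₁, hM₁⟩ := θ.exists_rowLen_eq_zero
  obtain ⟨M₂, hM₂⟩ := η.exists_rowLen_eq_zero
  have hθ := hM₁ (M₁ + M₂) (by omega)
  have hθ' := hM₁ (M₁ + M₂ + 1) (by omega)
  have hη := hM₂ (M₁ + M₂) (by omega)
  have hη' := hM₂ (M₁ + M₂ + 1) (by omega)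
  generalize M₁ + M₂ = M at hθ hθ' hη hη'
  have hM := h M
  have e1 := card_eq_sum_rowLen κ (M := M + 1) (by omega)
  have e2 := card_eq_sum_rowLen τ (M := M) (by omega)
  have e3 := card_eq_sum_rowLen θ hθ
  have e4 := card_eq_sum_rowLen η hη
  have e5 := sum_congr (rfl : range M = range M) fun i _ => h i
  have e6 := sum_range_succ' (fun i => max (θ.rowLen i) (η.rowLen i)) M
  have e7 := sum_range_succ (fun i => max (θ.rowLen i) (η.rowLen i)) M
  have e8 : ∑ i ∈ range M, max (θ.rowLen i) (η.rowLen i) +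
      ∑ i ∈ range M, min (θ.rowLen i) (η.rowLen i) =
      ∑ i ∈ range M, θ.rowLen i + ∑ i ∈ range M, η.rowLen i := by
    rw [← sum_add_distrib, ← sum_add_distrib]
    exact sum_congr rfl fun i _ => max_add_min _ _
  rw [sum_range_succ'] at e1
  rw [sum_add_distrib, sum_add_distrib] at e5
  -- The maximum at row `M` is 0, so shifting the index of the sum loses only row 0.
  simp only [hθ, hη, max_self] at e7
  omega

theorem isHorizontalStrip_growthDown (h : IsHorizontalStrip θ κ) (h' : IsHorizontalStrip η κ) :
    IsHorizontalStrip (growthDown θ η κ) θ ∧ IsHorizontalStrip (growthDown θ η κ) η := by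
  constructor <;>
  · intro i
    rw [rowLen_growthDown h h']
    have := h i
    have := h' i
    have := h (i + 1)
    have := h' (i + 1)
    omega

theorem isHorizontalStrip_growthUp (h : IsHorizontalStrip τ θ) (h' : IsHorizontalStrip τ η)
    (c : ℕ) :
    IsHorizontalStrip θ (growthUp θ η τ c) ∧ IsHorizontalStrip η (growthUp θ η τ c) := by
  constructor <;>
  · intro i
    rw [rowLen_growthUp h h', rowLen_growthUp h h']
    have := h i
    have := h' i
    cases i with
    | zero => dsimp only; omega
    | succ i =>
      have := h i
      have := h' i
      dsimp only; omega

theorem card_growthDown (h : IsHorizontalStrip θ κ) (h' : IsHorizontalStrip η κ) :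
    κ.card + (growthDown θ η κ).card =
      (κ.rowLen 0 - max (θ.rowLen 0) (η.rowLen 0)) + θ.card + η.card := by
  apply card_growth
  · have := h 0
    have := h' 0
    omega
  · intro i
    rw [rowLen_growthDown h h']
    have := h i
    have := h' i
    omega

theorem card_growthUp (h : IsHorizontalStrip τ θ) (h' : IsHorizontalStrip τ η) (c : ℕ) :
    (growthUp θ η τ c).card + τ.card = c + θ.card + η.card := by
  apply card_growth
  · rw [rowLen_growthUp h h']
  · intro i
    rw [rowLen_growthUp h h']
    have := h i
    have := h' i
    dsimp only
    omega

/-- Reflecting twice restores every row but row 0, whose excess over the maximum is carried by the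
label. -/
theorem growthUp_growthDown (h : IsHorizontalStrip θ κ) (h' : IsHorizontalStrip η κ) :
    growthUp θ η (growthDown θ η κ) (κ.rowLen 0 - max (θ.rowLen 0) (η.rowLen 0)) = κ := by
  obtain ⟨h1, h2⟩ := isHorizontalStrip_growthDown h h'
  apply ext_rowLen
  intro i
  rw [rowLen_growthUp h1 h2]
  cases i with
  | zero =>
    have := h 0
    have := h' 0
    dsimp only
    omega
  | succ i =>
    dsimp only
    rw [rowLen_growthDown h h']
    have := h i
    have := h' i
    omega

theorem growthDown_growthUp (h : IsHorizontalStrip τ θ) (h' : IsHorizontalStrip τ η) (c : ℕ) :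
    growthDown θ η (growthUp θ η τ c) = τ := by
  obtain ⟨h1, h2⟩ := isHorizontalStrip_growthUp h h' c
  apply ext_rowLen
  intro i
  rw [rowLen_growthDown h1 h2, rowLen_growthUp h h']
  have := h i
  have := h' i
  dsimp only
  omega

end YoungDiagram

/-! ### Tableaux with bounded entries and the branching rule -/

namespace SemistandardYoungTableau

variable {θ η : YoungDiagram}

/-- The cells of a semistandard tableau with entries less than `N`. -/
def shapeBelow (T : SemistandardYoungTableau θ) (N : ℕ) : YoungDiagram where
  cells := θ.cells.filter fun c => T c.1 c.2 < N
  isLowerSet := by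
    rintro ⟨i, j⟩ ⟨i', j'⟩ ⟨hi : i' ≤ i, hj : j' ≤ j⟩ hc
    simp only [coe_filter, YoungDiagram.mem_cells, Set.mem_ofPred_eq] at hc ⊢
    have h1 := θ.up_left_mem hi le_rfl hc.1
    exact ⟨θ.up_left_mem hi hj hc.1,
      ((T.row_weak_of_le hj h1).trans (T.col_weak hi hc.1)).trans_lt hc.2⟩

theorem mem_shapeBelow {T : SemistandardYoungTableau θ} {N i j : ℕ} :
    (i, j) ∈ T.shapeBelow N ↔ (i, j) ∈ θ ∧ T i j < N := by
  rw [← YoungDiagram.mem_cells, shapeBelow]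
  simp

/-- The restriction of a semistandard tableau to its entries less than `N`. -/
def restrictBelow (T : SemistandardYoungTableau θ) (N : ℕ) :
    SemistandardYoungTableau (T.shapeBelow N) where
  entry i j := if (i, j) ∈ T.shapeBelow N then T i j else 0
  row_weak' hj hc := by
    rw [if_pos hc, if_pos (YoungDiagram.up_left_mem _ le_rfl hj.le hc)]
    exact T.row_weak hj (mem_shapeBelow.1 hc).1
  col_strict' hi hc := by
    rw [if_pos hc, if_pos (YoungDiagram.up_left_mem _ hi.le le_rfl hc)]
    exact T.col_strict hi (mem_shapeBelow.1 hc).1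
  zeros' hc := if_neg hc

theorem restrictBelow_apply (T : SemistandardYoungTableau θ) (N i j : ℕ) :
    T.restrictBelow N i j = if (i, j) ∈ T.shapeBelow N then T i j else 0 := rfl

/-- Extend a tableau with entries less than `N` by the entry `N` along a horizontal strip. -/
def extendStrip (T : SemistandardYoungTableau η) (N : ℕ) (h : η.IsHorizontalStrip θ)
    (hT : ∀ i j, (i, j) ∈ η → T i j < N) : SemistandardYoungTableau θ where
  entry i j := if (i, j) ∈ η then T i j else if (i, j) ∈ θ then N else 0
  row_weak' {i j1 j2} hj hc := by
    by_cases h2 : (i, j2) ∈ η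
    · rw [if_pos h2, if_pos (η.up_left_mem le_rfl hj.le h2)]
      exact T.row_weak hj h2
    · rw [if_neg h2, if_pos hc]
      split_ifs with h3
      · exact (hT _ _ h3).le
      · exact le_rfl
      · exact Nat.zero_le _
  col_strict' {i1 i2 j} hi hc := by
    have h1 : (i1, j) ∈ η := h.mem_of_succ_mem (θ.up_left_mem hi le_rfl hc)
    rw [if_pos h1]
    split_ifs with h3
    · exact T.col_strict hi h3
    · exact hT _ _ h1
  zeros' {i j} hc := by
    rw [if_neg fun h' => hc (h.le h'), if_neg hc]

theorem extendStrip_apply (T : SemistandardYoungTableau η) (N : ℕ) (h : η.IsHorizontalStrip θ)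
    (hT : ∀ i j, (i, j) ∈ η → T i j < N) (i j : ℕ) :
    T.extendStrip N h hT i j = if (i, j) ∈ η then T i j else if (i, j) ∈ θ then N else 0 := rfl

/-- Columns are strict and `N` is the largest possible entry, so each column contains it at most
once, at its bottom. -/
theorem isHorizontalStrip_shapeBelow {T : SemistandardYoungTableau θ} {N : ℕ}
    (hT : ∀ i j, (i, j) ∈ θ → T i j < N + 1) : (T.shapeBelow N).IsHorizontalStrip θ := by
  refine .of_mem ?_ ?_
  · rintro ⟨i, j⟩ h
    exact (mem_shapeBelow.1 h).1
  · intro i j h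
    have := T.col_strict (Nat.lt_add_one i) h
    have := hT _ _ h
    exact mem_shapeBelow.2 ⟨θ.up_left_mem (Nat.le_succ i) le_rfl h, by omega⟩

theorem shapeBelow_extendStrip (T : SemistandardYoungTableau η) (N : ℕ)
    (h : η.IsHorizontalStrip θ) (hT : ∀ i j, (i, j) ∈ η → T i j < N) :
    (T.extendStrip N h hT).shapeBelow N = η := by
  apply YoungDiagram.ext
  ext ⟨i, j⟩
  rw [YoungDiagram.mem_cells, YoungDiagram.mem_cells, mem_shapeBelow, extendStrip_apply]
  by_cases h1 : (i, j) ∈ η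
  · simp [h1, h.le h1, hT]
  · by_cases h2 : (i, j) ∈ θ <;> simp [h1, h2]

/-- The semistandard tableaux with all entries less than `N`. -/
def below (N : ℕ) (θ : YoungDiagram) : Set (SemistandardYoungTableau θ) :=
  {T | ∀ i j, (i, j) ∈ θ → T i j < N}

theorem finite_below (N : ℕ) (θ : YoungDiagram) : (below N θ).Finite := by
  refine Set.Finite.of_injOn (f := fun T => fun c : θ.cells => T c.1.1 c.1.2)
    (t := Set.pi Set.univ fun _ => Set.Iio N) ?_ ?_ (Set.Finite.pi fun _ => Set.finite_Iio N)
  · exact fun T hT c _ => hT _ _ c.2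
  · intro S _ T _ hST
    apply SemistandardYoungTableau.ext
    intro i j
    by_cases hc : (i, j) ∈ θ
    · exact congrFun hST ⟨(i, j), hc⟩
    · rw [S.zeros hc, T.zeros hc]

end SemistandardYoungTableau

namespace StarOperation

open SemistandardYoungTableau

variable {θ η : YoungDiagram}

theorem content_extendStrip (T : SemistandardYoungTableau η) (N : ℕ)
    (h : η.IsHorizontalStrip θ) (hT : ∀ i j, (i, j) ∈ η → T i j < N) :
    content (T.extendStrip N h hT) = Finsupp.single N (θ.card - η.card) + content T := by
  have hsub := YoungDiagram.cells_subset_iff.2 h.le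
  unfold content
  rw [← sum_sdiff hsub]
  congr 1
  · rw [YoungDiagram.card, YoungDiagram.card, ← card_sdiff_of_subset hsub]
    rw [sum_congr rfl (g := fun _ => Finsupp.single N 1), sum_const, Finsupp.smul_single]
    · simp
    · rintro ⟨i, j⟩ hc
      rw [mem_sdiff, YoungDiagram.mem_cells, YoungDiagram.mem_cells] at hc
      simp [extendStrip_apply, hc]
  · refine sum_congr rfl ?_
    rintro ⟨i, j⟩ hc
    rw [YoungDiagram.mem_cells] at hc
    simp [extendStrip_apply, hc]

/-- The Schur polynomial in the variables `x_0, …, x_(N-1)`, as a power series. -/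
noncomputable def truncSchur (N : ℕ) (θ : YoungDiagram) : MvPowerSeries ℕ ℤ :=
  ∑ T ∈ (finite_below N θ).toFinset, MvPowerSeries.monomial (content T) 1

/-- Branching rule: the cells with entry `N` form a horizontal strip, and removing them leaves an
arbitrary tableau with entries below `N`. -/
theorem truncSchur_succ (N : ℕ) (θ : YoungDiagram) :
    truncSchur (N + 1) θ =
      ∑ η ∈ θ.removeStrip, MvPowerSeries.X N ^ (θ.card - η.card) * truncSchur N η := by
  simp only [truncSchur, mul_sum]
  rw [sum_sigma']
  symm
  have hT : ∀ x : (η : YoungDiagram) × SemistandardYoungTableau η,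
      x ∈ θ.removeStrip.sigma (fun η => (finite_below N η).toFinset) →
      x.1.IsHorizontalStrip θ ∧ ∀ i j, (i, j) ∈ x.1 → x.2 i j < N := by
    intro x hx
    simpa [below] using hx
  refine sum_bij (fun x hx => x.2.extendStrip N (hT x hx).1 (hT x hx).2) ?_ ?_ ?_ ?_
  · intro x hx
    rw [Set.Finite.mem_toFinset]
    intro i j hij
    rw [extendStrip_apply]
    split_ifs with h
    · exact ((hT x hx).2 i j h).trans N.lt_succ_self
    · exact N.lt_succ_self
  · rintro ⟨η, T⟩ hx ⟨η', T'⟩ hx' heq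
    have h1 := shapeBelow_extendStrip T N (hT _ hx).1 (hT _ hx).2
    have h2 := shapeBelow_extendStrip T' N (hT _ hx').1 (hT _ hx').2
    dsimp only at heq
    rw [heq] at h1
    obtain rfl : η = η' := h1.symm.trans h2
    congr 1
    apply SemistandardYoungTableau.ext
    intro i j
    by_cases hc : (i, j) ∈ η
    · have := congrArg (fun S : SemistandardYoungTableau θ => S i j) heq
      simpa [extendStrip_apply, hc] using this
    · rw [T.zeros hc, T'.zeros hc]
  · intro T hTm
    rw [Set.Finite.mem_toFinset] at hTm
    refine ⟨⟨T.shapeBelow N, T.restrictBelow N⟩, ?_, ?_⟩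
    · simp only [mem_sigma, YoungDiagram.mem_removeStrip, Set.Finite.mem_toFinset]
      refine ⟨isHorizontalStrip_shapeBelow hTm, fun i j h => ?_⟩
      rw [restrictBelow_apply, if_pos h]
      exact (mem_shapeBelow.1 h).2
    · apply SemistandardYoungTableau.ext
      intro i j
      rw [extendStrip_apply, restrictBelow_apply]
      by_cases h : (i, j) ∈ T.shapeBelow N
      · simp [h]
      · rw [if_neg h]
        rw [mem_shapeBelow] at h
        by_cases hc : (i, j) ∈ θ
        · rw [if_pos hc]
          have := hTm i j hc
          have : ¬ T i j < N := fun h' => h ⟨hc, h'⟩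
          omega
        · rw [if_neg hc, T.zeros hc]
  · rintro ⟨η, T⟩ hx
    rw [content_extendStrip, MvPowerSeries.X_pow_eq, MvPowerSeries.monomial_mul_monomial, mul_one]

open Classical in
theorem truncSchur_zero (θ : YoungDiagram) : truncSchur 0 θ = if θ = ⊥ then 1 else 0 := by
  split_ifs with h
  · subst h
    have : (finite_below 0 (⊥ : YoungDiagram)).toFinset = {default} := by
      ext T
      rw [Set.Finite.mem_toFinset, mem_singleton]
      constructor
      · intro _
        apply SemistandardYoungTableau.ext
        intro i j
        rw [T.zeros (YoungDiagram.notMem_bot _),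
          SemistandardYoungTableau.zeros _ (YoungDiagram.notMem_bot _)]
      · exact fun _ i j hc => absurd hc (YoungDiagram.notMem_bot _)
    rw [truncSchur, this, sum_singleton, content]
    simp [MvPowerSeries.monomial_zero_one]
  · rw [truncSchur, sum_eq_zero]
    intro T hT
    rw [Set.Finite.mem_toFinset] at hT
    refine absurd ?_ h
    apply YoungDiagram.ext
    ext ⟨i, j⟩
    simpa using fun hc => Nat.not_lt_zero _ (hT i j hc)

/-- Transfers identities from finitely to infinitely many variables: a tableau of content `d` uses
only entries below `N`. -/
theorem coeff_truncSchur (N : ℕ) (θ : YoungDiagram) {d : ℕ →₀ ℕ} (hd : ∀ i, N ≤ i → d i = 0) :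
    MvPowerSeries.coeff d (truncSchur N θ) = MvPowerSeries.coeff d (schur θ) := by
  classical
  have hr : MvPowerSeries.coeff d (schur θ) =
      (Nat.card {T : SemistandardYoungTableau θ // content T = d} : ℤ) := rfl
  rw [hr, truncSchur, map_sum]
  simp only [MvPowerSeries.coeff_monomial]
  rw [sum_boole]
  have : Nat.card {T : SemistandardYoungTableau θ // content T = d} =
      ((finite_below N θ).toFinset.filter fun T => d = content T).card := by
    refine Nat.subtype_card _ fun T => ?_
    rw [mem_filter, Set.Finite.mem_toFinset]
    refine ⟨fun h => h.2.symm, fun h => ⟨fun i j hc => ?_, h.symm⟩⟩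
    by_contra hlt
    have h0 := hd _ (not_lt.1 hlt)
    rw [← h, content, Finsupp.finsetSum_apply, sum_eq_zero_iff] at h0
    simpa using h0 (i, j) hc
  rw [this]

theorem rowLen_oneRow (a i : ℕ) : (oneRow a).rowLen i = if i = 0 then a else 0 := by
  have key : ∀ j, j < (oneRow a).rowLen i ↔ j < if i = 0 then a else 0 := by
    intro j
    rw [← YoungDiagram.mem_iff_lt_rowLen, oneRow, YoungDiagram.mem_ofRowLens]
    cases i <;> simp
  have h1 := key (if i = 0 then a else 0)
  have h2 := key ((oneRow a).rowLen i)
  omega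

theorem addStrip_bot (a : ℕ) : (⊥ : YoungDiagram).addStrip a = {oneRow a} := by
  have hbot : ∀ i, (⊥ : YoungDiagram).rowLen i = 0 := fun i => by
    by_contra h
    exact YoungDiagram.notMem_bot _ (YoungDiagram.mem_iff_lt_rowLen.2 (Nat.pos_of_ne_zero h))
  have h0 := rowLen_oneRow a
  ext κ
  rw [YoungDiagram.mem_addStrip, mem_singleton]
  constructor
  · rintro ⟨h, hc⟩
    have h1 : ∀ i, κ.rowLen (i + 1) = 0 := fun i => by
      have := (h i).1
      have := hbot i
      omega
    rw [κ.card_eq_sum_rowLen (h1 0)] at hc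
    apply YoungDiagram.ext_rowLen
    intro i
    cases i with
    | zero => simpa [h0, YoungDiagram.card] using hc
    | succ i => rw [h1, h0]; simp
  · rintro rfl
    refine ⟨fun i => ?_, ?_⟩
    · simp [hbot, h0]
    · rw [(oneRow a).card_eq_sum_rowLen (M := 1) (by simp [h0])]
      simp [h0, YoungDiagram.card]

theorem removeStrip_bot : (⊥ : YoungDiagram).removeStrip = {⊥} := by
  ext η
  rw [YoungDiagram.mem_removeStrip, mem_singleton]
  constructor
  · exact fun h => le_bot_iff.1 h.le
  · rintro rfl
    exact .of_mem le_rfl fun i j h => absurd h (YoungDiagram.notMem_bot _)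

theorem truncSchur_bot (N : ℕ) : truncSchur N ⊥ = 1 := by
  induction N with
  | zero => rw [truncSchur_zero, if_pos rfl]
  | succ N ih => rw [truncSchur_succ, removeStrip_bot, sum_singleton, ih]; simp

end StarOperation

/-! ### Commutation of adding and removing horizontal strips -/

namespace YoungDiagram

/-- The growth rules exchange the upper corner `κ` for the lower corner `τ` and a label `c`, keeping
`θ` and `η`; `card_growth` matches the exponents of `x`. -/
theorem sum_addStrip_removeStrip {R : Type*} [CommRing R] (x : R) (F : YoungDiagram → R)
    (θ : YoungDiagram) (a : ℕ) :
    ∑ κ ∈ θ.addStrip a, ∑ η ∈ κ.removeStrip, x ^ (κ.card - η.card) * F η =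
      ∑ c ∈ range (a + 1), ∑ τ ∈ θ.removeStrip, ∑ η ∈ τ.addStrip (a - c),
        x ^ (c + (θ.card - τ.card)) * F η := by
  simp only [sum_sigma']
  refine sum_bij'
    (fun y _ => ⟨y.1.rowLen 0 - max (θ.rowLen 0) (y.2.rowLen 0), growthDown θ y.2 y.1, y.2⟩)
    (fun z _ => ⟨growthUp θ z.2.2 z.2.1 z.1, z.2.2⟩) ?_ ?_ ?_ ?_ ?_
  · rintro ⟨κ, η⟩ hy
    simp only [mem_sigma, mem_addStrip, mem_removeStrip, mem_range] at hy ⊢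
    obtain ⟨⟨h, hc⟩, h'⟩ := hy
    obtain ⟨h1, h2⟩ := isHorizontalStrip_growthDown h h'
    have := card_growthDown h h'
    have := h2.card_le
    exact ⟨by omega, h1, h2, by omega⟩
  · rintro ⟨c, τ, η⟩ hz
    simp only [mem_sigma, mem_addStrip, mem_removeStrip, mem_range] at hz ⊢
    obtain ⟨hca, h, h', hc⟩ := hz
    obtain ⟨h1, h2⟩ := isHorizontalStrip_growthUp h h' c
    have := card_growthUp h h' c
    exact ⟨⟨h1, by omega⟩, h2⟩
  · rintro ⟨κ, η⟩ hy
    simp only [mem_sigma, mem_addStrip, mem_removeStrip] at hy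
    obtain ⟨⟨h, hc⟩, h'⟩ := hy
    simp only [growthUp_growthDown h h']
  · rintro ⟨c, τ, η⟩ hz
    simp only [mem_sigma, mem_addStrip, mem_removeStrip] at hz
    obtain ⟨-, h, h', hc⟩ := hz
    have h0 : (growthUp θ η τ c).rowLen 0 = max (θ.rowLen 0) (η.rowLen 0) + c :=
      rowLen_growthUp h h' c 0
    simp only [growthDown_growthUp h h', h0, add_tsub_cancel_left]
  · rintro ⟨κ, η⟩ hy
    simp only [mem_sigma, mem_addStrip, mem_removeStrip] at hy
    obtain ⟨⟨h, hc⟩, h'⟩ := hy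
    obtain ⟨h1, h2⟩ := isHorizontalStrip_growthDown h h'
    have := card_growthDown h h'
    have := h1.card_le
    have := h'.card_le
    dsimp only
    congr 2
    omega

end YoungDiagram

/-! ### The Pieri rule -/

namespace StarOperation

/-- Branching in the last variable and the commutation of strips express the right-hand side as the
polynomial of `θ` times a factor independent of `θ`. -/
theorem truncSchur_oneRow_mul (N : ℕ) (θ : YoungDiagram) (a : ℕ) :
    truncSchur N (oneRow a) * truncSchur N θ = ∑ κ ∈ θ.addStrip a, truncSchur N κ := by
  classical
  induction N generalizing θ a with
  | zero =>
    by_cases h : θ = ⊥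
    · rw [h, addStrip_bot, truncSchur_bot, mul_one, sum_singleton]
    · rw [truncSchur_zero θ, if_neg h, mul_zero, sum_eq_zero]
      intro κ hκ
      rw [YoungDiagram.mem_addStrip] at hκ
      rw [truncSchur_zero, if_neg]
      rintro rfl
      exact h (le_bot_iff.1 hκ.1.le)
  | succ N ih =>
    have key : ∀ (θ : YoungDiagram) (a : ℕ), ∑ κ ∈ θ.addStrip a, truncSchur (N + 1) κ =
        (∑ c ∈ range (a + 1), MvPowerSeries.X N ^ c * truncSchur N (oneRow (a - c))) *
          truncSchur (N + 1) θ := by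
      intro θ a
      simp only [truncSchur_succ]
      rw [YoungDiagram.sum_addStrip_removeStrip, sum_mul_sum]
      refine sum_congr rfl fun c _ => sum_congr rfl fun τ _ => ?_
      rw [← mul_sum, ← ih, pow_add]
      ring
    -- The empty shape identifies the common factor as the one-row polynomial in `N + 1` variables.
    have hbot := key ⊥ a
    rw [addStrip_bot, sum_singleton, truncSchur_bot, mul_one] at hbot
    rw [hbot, key]

/-- The **Pieri rule**. -/
theorem completeHomogeneous_mul_schur (a : ℕ) (θ : YoungDiagram) :
    completeHomogeneous a * schur θ = ∑ κ ∈ θ.addStrip a, schur κ := by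
  classical
  apply MvPowerSeries.ext
  intro d
  obtain ⟨N, hN⟩ : ∃ N, ∀ i, N ≤ i → d i = 0 := by
    refine ⟨d.support.sup id + 1, fun i hi => ?_⟩
    by_contra h
    have : i ≤ d.support.sup id := Finset.le_sup (f := id) (Finsupp.mem_support_iff.2 h)
    omega
  have h := congrArg (MvPowerSeries.coeff d) (truncSchur_oneRow_mul N θ a)
  rw [MvPowerSeries.coeff_mul, map_sum] at h
  rw [completeHomogeneous, MvPowerSeries.coeff_mul, map_sum]
  simp only [coeff_truncSchur N _ hN] at h
  rw [← h]
  refine sum_congr rfl fun p hp => ?_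
  rw [HasAntidiagonal.mem_antidiagonal] at hp
  have hi : ∀ i, N ≤ i → p.1 i = 0 ∧ p.2 i = 0 := fun i hi => by
    have := hN i hi
    rw [← hp, Finsupp.add_apply] at this
    omega
  rw [coeff_truncSchur N _ fun i h => (hi i h).1, coeff_truncSchur N _ fun i h => (hi i h).2]

theorem completeHomogeneous_mul (a b : ℕ) :
    completeHomogeneous a * completeHomogeneous b = ∑ κ ∈ (oneRow b).addStrip a, schur κ :=
  completeHomogeneous_mul_schur a (oneRow b)

/-! ### The Schur cone and products of two complete homogeneous functions -/

/-- The cone of nonnegative integral combinations of Schur functions. -/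
noncomputable def schurCone : AddSubmonoid (MvPowerSeries ℕ ℤ) :=
  AddSubmonoid.closure (Set.range schur)

theorem schur_mem_schurCone (θ : YoungDiagram) : schur θ ∈ schurCone :=
  AddSubmonoid.subset_closure ⟨θ, rfl⟩

theorem schurPositive_of_mem_schurCone {f : MvPowerSeries ℕ ℤ} (hf : f ∈ schurCone) :
    SchurPositive f := by
  classical
  induction hf using AddSubmonoid.closure_induction with
  | mem f hf =>
    obtain ⟨θ, rfl⟩ := hf
    refine ⟨Finsupp.single θ 1, by simp, fun η => ?_⟩
    rw [Finsupp.single_apply]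
    split_ifs <;> simp
  | zero => exact ⟨0, by simp, fun _ => le_rfl⟩
  | add f g _ _ hf hg =>
    obtain ⟨c, rfl, hc⟩ := hf
    obtain ⟨e, rfl, he⟩ := hg
    refine ⟨c + e, ?_, fun θ => add_nonneg (hc θ) (he θ)⟩
    exact (Finsupp.sum_add_index' (h := fun θ (a : ℤ) => a • schur θ) (fun _ => zero_smul _ _)
      fun _ _ _ => add_smul _ _ _).symm

theorem completeHomogeneous_mul_mem (a : ℕ) {f : MvPowerSeries ℕ ℤ} (hf : f ∈ schurCone) :
    completeHomogeneous a * f ∈ schurCone := by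
  induction hf using AddSubmonoid.closure_induction with
  | mem f hf =>
    obtain ⟨θ, rfl⟩ := hf
    rw [completeHomogeneous_mul_schur]
    exact sum_mem fun κ _ => schur_mem_schurCone κ
  | zero => rw [mul_zero]; exact zero_mem _
  | add f g _ _ hf hg => rw [mul_add]; exact add_mem hf hg

theorem mem_addStrip_oneRow {κ : YoungDiagram} {a b : ℕ} :
    κ ∈ (oneRow b).addStrip a ↔
      κ.rowLen 1 ≤ b ∧ b ≤ κ.rowLen 0 ∧ κ.rowLen 2 = 0 ∧ κ.card = b + a := by
  have hb : ∀ i, (oneRow b).rowLen i = if i = 0 then b else 0 := rowLen_oneRow b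
  have hcard : (oneRow b).card = b := by
    rw [(oneRow b).card_eq_sum_rowLen (M := 1) (by simp [hb])]
    simp [hb]
  rw [YoungDiagram.mem_addStrip, hcard]
  constructor
  · rintro ⟨h, hc⟩
    have h0 := h 0
    have h1 := h 1
    simp only [hb] at h0 h1
    simp at h0 h1
    exact ⟨h0.1, h0.2, h1, hc⟩
  · rintro ⟨h0, h1, h2, hc⟩
    refine ⟨fun i => ?_, hc⟩
    rw [hb]
    rcases i with _ | _ | i
    · exact ⟨h0, h1⟩
    · simp [h2]
    · have := κ.rowLen_anti 2 (i + 1 + 1 + 1) (by omega)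
      simp; omega

/-- By Pieri, `h_a h_b` is the multiplicity-free sum over shapes of size `a + b` with at most two
rows and first row at least `max a b`. Lowering the maximum with the sum fixed only enlarges this
set. -/
theorem sub_mem_schurCone_of_le {p q p' q' : ℕ} (hsum : p' + q' = p + q) (hp : p' ≤ p)
    (hq : q' ≤ p) :
    completeHomogeneous p' * completeHomogeneous q' -
      completeHomogeneous p * completeHomogeneous q ∈ schurCone := by
  classical
  wlog hpq : q' ≤ p' generalizing p' q'
  · rw [mul_comm (completeHomogeneous p')]
    exact this (by omega) hq hp (by omega)
  have hsub : (oneRow p).addStrip q ⊆ (oneRow p').addStrip q' := by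
    intro κ hκ
    rw [mem_addStrip_oneRow] at hκ ⊢
    obtain ⟨h0, h1, h2, hc⟩ := hκ
    have := hc
    rw [κ.card_eq_sum_rowLen h2, sum_range_succ, sum_range_one] at this
    exact ⟨by omega, by omega, h2, by omega⟩
  rw [mul_comm, completeHomogeneous_mul, mul_comm (completeHomogeneous p),
    completeHomogeneous_mul, ← sum_sdiff hsub, add_sub_cancel_right]
  exact sum_mem fun κ _ => schur_mem_schurCone κ

theorem prod_mul_mem_schurCone {α : Type*} (w : α → ℕ) (r : Multiset α)
    {f : MvPowerSeries ℕ ℤ} (hf : f ∈ schurCone) :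
    (r.map fun i => completeHomogeneous (w i)).prod * f ∈ schurCone := by
  induction r using Multiset.induction_on with
  | empty => simpa
  | cons i r ih =>
    rw [Multiset.map_cons, Multiset.prod_cons, mul_assoc]
    exact completeHomogeneous_mul_mem _ ih

theorem prod_sub_prod_mem_schurCone {ι κ : Type*} {s : Multiset ι} {t : Multiset κ}
    {u u' : ι → ℕ} {v v' : κ → ℕ}
    (h : Multiset.Rel (fun i j => completeHomogeneous (u' i) * completeHomogeneous (v' j) -
      completeHomogeneous (u i) * completeHomogeneous (v j) ∈ schurCone) s t) :
    (s.map fun i => completeHomogeneous (u' i)).prod *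
        (t.map fun j => completeHomogeneous (v' j)).prod -
      (s.map fun i => completeHomogeneous (u i)).prod *
        (t.map fun j => completeHomogeneous (v j)).prod ∈ schurCone := by
  induction h with
  | zero => simp
  | @cons i j s t hij _ ih =>
    simp only [Multiset.map_cons, Multiset.prod_cons]
    -- Telescoping: `x' P' - x P = x' (P' - P) + (x' - x) P`, where `x`, `x'` are the products for
    -- the pair `i`, `j` and `P`, `P'` those for the rest.
    have h1 := completeHomogeneous_mul_mem (u' i) (completeHomogeneous_mul_mem (v' j) ih)
    have h2 := prod_mul_mem_schurCone u s (prod_mul_mem_schurCone v t hij)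
    convert add_mem h1 h2 using 1
    ring

end StarOperation

/-! ### Matching the up-steps and down-steps of a lattice path -/

namespace StarOperation

section Crossings

variable {ι κ : Type*} (u : ι → ℤ) (v : κ → ℤ)

/-- The number of `i' ∈ A` with `u i'` at least `x` minus the number of `j ∈ B` with `v j` at
least `x`. -/
def excess (A : Finset ι) (B : Finset κ) (x : ℤ) : ℤ :=
  ((A.filter fun i => x ≤ u i).card : ℤ) - ((B.filter fun j => x ≤ v j).card : ℤ)

/-- The number of `i ∈ A` with `u i` greater than `x` minus the number of `j ∈ B` with `v j`
greater than `x`. -/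
def strictExcess (A : Finset ι) (B : Finset κ) (x : ℤ) : ℤ :=
  ((A.filter fun i => x < u i).card : ℤ) - ((B.filter fun j => x < v j).card : ℤ)

variable {u v} {A : Finset ι} {B : Finset κ}

theorem card_filter_eq_add_erase {α : Type*} [DecidableEq α] {s : Finset α} {a : α} (ha : a ∈ s)
    (p : α → Prop) [DecidablePred p] :
    (s.filter p).card = (if p a then 1 else 0) + ((s.erase a).filter p).card := by
  rw [card_filter, card_filter, add_sum_erase s (fun i => if p i then 1 else 0) ha]

/-- The first change of letter in the merged decreasing sequence of the `u i` and the `v j`, where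
`v j` comes before `u i` in case of equality. -/
theorem exists_adjacent (hu : u.Injective) (hv : v.Injective) (hA : A.Nonempty)
    (hB : B.Nonempty) :
    ∃ i ∈ A, ∃ j ∈ B, (∀ i' ∈ A, i' ≠ i → (u i ≤ u i' ↔ v j < u i')) ∧
      (∀ j' ∈ B, j' ≠ j → (u i ≤ v j' ↔ v j < v j')) ∧
      (v j < u i ↔ 0 < excess u v A B (u i)) := by
  -- The cases are the two possible first letters. An initial run of `u`s ends in a peak of positive
  -- height; an initial run of `v`s ends in a valley, after which the up-step reaches height at most
  -- 0.
  by_cases h : ∃ i₀ ∈ A, ∀ j ∈ B, v j < u i₀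
  · obtain ⟨i₀, hi₀, h₀⟩ := h
    obtain ⟨j, hj, hjmax⟩ := B.exists_max_image v hB
    obtain ⟨i, hi, himin⟩ := (A.filter fun i => v j < u i).exists_min_image u
      ⟨i₀, mem_filter.2 ⟨hi₀, h₀ j hj⟩⟩
    rw [mem_filter] at hi
    refine ⟨i, hi.1, j, hj, fun i' hi' _ => ⟨fun h => hi.2.trans_le h, fun h =>
      himin i' (mem_filter.2 ⟨hi', h⟩)⟩, fun j' hj' _ => ?_, ?_⟩
    · have := hjmax j' hj'
      omega
    · have h1 : 0 < (A.filter fun i' => u i ≤ u i').card :=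
        card_pos.2 ⟨i, mem_filter.2 ⟨hi.1, le_rfl⟩⟩
      have h2 : (B.filter fun j' => u i ≤ v j').card = 0 := by
        rw [card_eq_zero, filter_eq_empty_iff]
        intro j' hj'
        have := hjmax j' hj'
        omega
      have := hi.2
      unfold excess
      omega
  · push Not at h
    obtain ⟨i, hi, himax⟩ := A.exists_max_image u hA
    obtain ⟨j₀, hj₀, h₀⟩ := h i hi
    obtain ⟨j, hj, hjmin⟩ := (B.filter fun j => u i ≤ v j).exists_min_image v
      ⟨j₀, mem_filter.2 ⟨hj₀, h₀⟩⟩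
    rw [mem_filter] at hj
    refine ⟨i, hi, j, hj.1, fun i' hi' hne => ?_, fun j' hj' hne => ⟨fun h => ?_, fun h =>
      hj.2.trans h.le⟩, ?_⟩
    · have := himax i' hi'
      have := hu.ne hne
      have := hj.2
      omega
    · have := hjmin j' (mem_filter.2 ⟨hj', h⟩)
      have := hv.ne hne
      omega
    · have h1 : (A.filter fun i' => u i ≤ u i').card ≤ 1 := by
        refine card_le_one.2 fun a ha b hb => hu ?_
        rw [mem_filter] at ha hb
        have := himax a ha.1
        have := himax b hb.1
        omega
      have h2 : 0 < (B.filter fun j' => u i ≤ v j').card :=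
        card_pos.2 ⟨j, mem_filter.2 hj⟩
      have := hj.2
      unfold excess
      omega

/-- Match the two steps at the first peak or valley, delete them and recurse: every other step lies
before both or after both, so its height is unchanged. -/
theorem rel_of_excess_eq [DecidableEq ι] [DecidableEq κ] (hu : u.Injective) (hv : v.Injective) (hcard : A.card = B.card)
    {e : ι → ℤ} {f : κ → ℤ} (he : ∀ i ∈ A, excess u v A B (u i) = e i)
    (hf : ∀ j ∈ B, strictExcess u v A B (v j) = f j) {R : ι → κ → Prop}
    (hR : ∀ i j, e i = f j → (v j < u i ↔ 0 < e i) → R i j) :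
    Multiset.Rel R A.val B.val := by
  induction hn : A.card generalizing A B with
  | zero =>
    obtain rfl := card_eq_zero.1 hn
    obtain rfl := card_eq_zero.1 (hcard.symm.trans hn)
    exact .zero
  | succ n ih =>
    obtain ⟨i, hi, j, hj, hA, hB, hs⟩ := exists_adjacent hu hv
      (card_pos.1 (by omega) : A.Nonempty) (card_pos.1 (by omega) : B.Nonempty)
    have hrel : R i j := by
      refine hR i j ?_ (by rw [← he i hi]; exact hs)
      -- `excess` counts `i` itself while `strictExcess` omits `j`, so both measure the upper end of
      -- a step; these upper ends agree at a peak and at a valley.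
      rw [← he i hi, ← hf j hj, excess, strictExcess, card_filter_eq_add_erase hi,
        card_filter_eq_add_erase hj, card_filter_eq_add_erase hi, card_filter_eq_add_erase hj,
        filter_congr fun i' hi' => hA i' (mem_of_mem_erase hi') (ne_of_mem_erase hi'),
        filter_congr fun j' hj' => hB j' (mem_of_mem_erase hj') (ne_of_mem_erase hj')]
      simp only [le_refl, lt_irrefl, if_true, if_false]
      split_ifs <;> push_cast <;> omega
    rw [← insert_erase hi, ← insert_erase hj, insert_val_of_notMem (notMem_erase _ _),
      insert_val_of_notMem (notMem_erase _ _)]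
    refine .cons hrel (ih ?_ ?_ ?_ ?_)
    · rw [card_erase_of_mem hi, card_erase_of_mem hj, hcard]
    · intro i' hi'
      rw [mem_erase] at hi'
      rw [← he i' hi'.2, excess, excess, card_filter_eq_add_erase hi (fun x => u i' ≤ u x),
        card_filter_eq_add_erase hj (fun x => u i' ≤ v x)]
      -- The erased pair contributes `1 - 1` or `0 - 0` to the excess at `u i'`.
      have := hA i' hi'.2 hi'.1
      have := hu.ne hi'.1
      split_ifs <;> push_cast <;> omega
    · intro j' hj'
      rw [mem_erase] at hj'
      rw [← hf j' hj'.2, strictExcess, strictExcess,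
        card_filter_eq_add_erase hi (fun x => v j' < u x),
        card_filter_eq_add_erase hj (fun x => v j' < v x)]
      have := hB j' hj'.2 hj'.1
      have := hv.ne hj'.1
      split_ifs <;> push_cast <;> omega
    · rw [card_erase_of_mem hi, hn, Nat.add_sub_cancel]

end Crossings

/-! ### The parts of `λ` and `ρ` as path heights, and their bounds -/

variable {n : ℕ}

theorem PaddedPartition.card_filter_shifted_ge (p : PaddedPartition n) (k : Fin n) :
    (univ.filter fun j => p.shifted j ≥ p.shifted k).card = (k : ℕ) + 1 := by
  rw [← Fin.card_Iic]
  congr 1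
  ext j
  simp [p.shifted_strictAnti.le_iff_ge]

theorem PaddedPartition.card_filter_shifted_gt (p : PaddedPartition n) (k : Fin n) :
    (univ.filter fun j => p.shifted j > p.shifted k).card = (k : ℕ) := by
  rw [← Fin.card_Iio]
  congr 1
  ext j
  simp [p.shifted_strictAnti.lt_iff_gt]

/-- The shift `-k` is minus the number of shifted parts of `μ` that are at least the `k`-th one. -/
theorem lambdaPart_eq_sub_excess (μ ν : PaddedPartition n) (k : Fin n) :
    lambdaPart μ ν k = μ.parts k - excess μ.shifted ν.shifted univ univ (μ.shifted k) := by
  have h := μ.card_filter_shifted_ge k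
  have h' : μ.shifted k = (μ.parts k : ℤ) - ((k : ℤ) + 1) := rfl
  simp only [ge_iff_le] at h
  simp only [lambdaPart, excess, ge_iff_le, h]
  push_cast
  linarith

theorem rhoPart_eq_add_strictExcess (μ ν : PaddedPartition n) (j : Fin n) :
    rhoPart μ ν j =
      ν.parts j + strictExcess μ.shifted ν.shifted univ univ (ν.shifted j) := by
  have h := ν.card_filter_shifted_gt j
  have h' : ν.shifted j = (ν.parts j : ℤ) - ((j : ℤ) + 1) := rfl
  simp only [gt_iff_lt] at h
  simp only [rhoPart, strictExcess, gt_iff_lt, h]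
  linarith

/-- Shifted parts are distinct integers, so at most `μ.shifted k - ν.shifted j - 1` of those of `μ`
lie strictly between the two values; the others counted by `rhoPart` have index at most `k`. -/
theorem rhoPart_le_of_lt (μ ν : PaddedPartition n) {k j : Fin n}
    (h : ν.shifted j < μ.shifted k) : rhoPart μ ν j ≤ μ.parts k := by
  have h1 := card_shifted_le μ (a := ν.shifted j + 1) (b := μ.shifted k) (by omega)
  have h2 : μ.shifted k = (μ.parts k : ℤ) - ((k : ℤ) + 1) := rfl
  rw [μ.card_filter_shifted_ge k] at h1
  simp only [ge_iff_le, Int.add_one_le_iff] at h1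
  simp only [rhoPart, gt_iff_lt]
  push_cast at h1
  linarith

theorem lambdaPart_le_of_le (μ ν : PaddedPartition n) {k j : Fin n}
    (h : μ.shifted k ≤ ν.shifted j) : lambdaPart μ ν k ≤ ν.parts j := by
  have h1 := card_shifted_le ν h
  have h2 : ν.shifted j = (ν.parts j : ℤ) - ((j : ℤ) + 1) := rfl
  rw [ν.card_filter_shifted_ge j] at h1
  unfold lambdaPart
  push_cast at h1
  linarith

end StarOperation

theorem proposition2p3 (n : ℕ) (μ ν lam rho : StarOperation.PaddedPartition n)
    (h : (lam, rho) = StarOperation.star (μ, ν)) :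
    StarOperation.SchurPositive
      (StarOperation.completeHomogeneousProd lam * StarOperation.completeHomogeneousProd rho -
        StarOperation.completeHomogeneousProd μ * StarOperation.completeHomogeneousProd ν) := by
  apply StarOperation.schurPositive_of_mem_schurCone
  have hlam : ∀ k, (lam.parts k : ℤ) = StarOperation.lambdaPart μ ν k := fun k => by
    rw [← StarOperation.star_fst_parts, ← h]
  have hrho : ∀ j, (rho.parts j : ℤ) = StarOperation.rhoPart μ ν j := fun j => by
    rw [← StarOperation.star_snd_parts, ← h]
  apply StarOperation.prod_sub_prod_mem_schurCone (s := univ.val) (t := univ.val)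
    (u := μ.parts) (u' := lam.parts) (v := ν.parts) (v' := rho.parts)
  apply StarOperation.rel_of_excess_eq μ.shifted_strictAnti.injective
    ν.shifted_strictAnti.injective rfl (fun _ _ => rfl) (fun _ _ => rfl)
  intro k j hkj hsign
  have hk := hlam k
  have hj := hrho j
  rw [StarOperation.lambdaPart_eq_sub_excess] at hk
  rw [StarOperation.rhoPart_eq_add_strictExcess] at hj
  -- The earlier step of the pair has the dominating part: `μ_k` if up comes first, `ν_j` otherwise.
  -- The sign of the height bounds one new part by it, the counting lemma the other.
  by_cases hlt : ν.shifted j < μ.shifted k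
  · have h1 := StarOperation.rhoPart_le_of_lt μ ν hlt
    rw [← hrho] at h1
    have := hsign.1 hlt
    exact StarOperation.sub_mem_schurCone_of_le (by omega) (by omega) (by omega)
  · have h1 := StarOperation.lambdaPart_le_of_le μ ν (not_lt.1 hlt)
    rw [← hlam] at h1
    have := mt hsign.2 hlt
    rw [mul_comm (StarOperation.completeHomogeneous (μ.parts k))]
    exact StarOperation.sub_mem_schurCone_of_le (by omega) (by omega) (by omega)
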